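/- Let $(C,<)$ be a linear order that embeds a dense linear order, i.e. there are a linear order $D$ with at least two elements, in which between any two distinct elements there lies a third, and an order embedding $D\hookrightarrow C$. Then $C$ has no monadically definable choice function, even with parameters. That is: there are no finite sequence $\bar P=(P_0,\dots,P_{l-1})$ of subsets of $C$ and no formula $\varphi(x,X,\bar Z)$ of the monadic second-order language of order (the language with $=$, $<$ and $x\in X$, and with quantification over elements and over arbitrary subsets) such that the following three conditions all hold: 1. for all $a\in C$ and $A\subseteq C$, if $C\models\varphi(a,A,\bar P)$ then $A\neq\emptyset$ and $a\in A$; 2. for every non-empty $A\subseteq C$ there is $a\in C$ with $C\models\varphi(a,A,\bar P)$; 3. for all $a,b\in C$ and $A\subseteq C$, if $C\models\varphi(a,A,\bar P)$ and $C\models\varphi(b,A,\bar P)$ then $a=b$. -/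

import Mathlib

universe u

namespace MonadicOrder

/-- Formulas of the monadic second-order language of order `{<}` (with equality), written with
de Bruijn indices: `MFormula m n` has free element variables among `x₀, …, x_{m-1}` and free
set variables among `X₀, …, X_{n-1}`. A quantifier binds the variable with index `0` of its sort
and shifts the other variables of that sort by one. The remaining connectives, the universal
quantifiers, `≤` and "`X` is a singleton" are definable from these. -/
inductive MFormula : ℕ → ℕ → Type
  | eq {m n : ℕ} (i j : Fin m) : MFormula m n
  | lt {m n : ℕ} (i j : Fin m) : MFormula m n
  | mem {m n : ℕ} (i : Fin m) (k : Fin n) : MFormula m n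
  | neg {m n : ℕ} (φ : MFormula m n) : MFormula m n
  | and {m n : ℕ} (φ ψ : MFormula m n) : MFormula m n
  | exElem {m n : ℕ} (φ : MFormula (m + 1) n) : MFormula m n
  | exSet {m n : ℕ} (φ : MFormula m (n + 1)) : MFormula m n

/-- Satisfaction in `(C, <)`: element variables range over `C`, set variables over all subsets
of `C`. -/
def MFormula.Realize {C : Type u} [LT C] :
    {m n : ℕ} → MFormula m n → (Fin m → C) → (Fin n → Set C) → Prop
  | _, _, .eq i j, x, _ => x i = x j
  | _, _, .lt i j, x, _ => x i < x j
  | _, _, .mem i k, x, X => x i ∈ X k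
  | _, _, .neg φ, x, X => ¬ φ.Realize x X
  | _, _, .and φ ψ, x, X => φ.Realize x X ∧ ψ.Realize x X
  | _, _, .exElem φ, x, X => ∃ a : C, φ.Realize (Fin.cons a x : Fin _ → C) X
  | _, _, .exSet φ, x, X => ∃ A : Set C, φ.Realize x (Fin.cons A X : Fin _ → Set C)

/-- `C ⊨ φ(a, A, P₀, …, P_{l-1})`: the one free element variable of `φ` is interpreted by `a`, its
first free set variable by `A`, and the remaining `l` set variables by the parameters `P`. -/
def Holds {C : Type u} [LT C] {l : ℕ} (φ : MFormula 1 (l + 1)) (a : C) (A : Set C)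
    (P : Fin l → Set C) : Prop :=
  φ.Realize (fun _ => a) (Fin.cons A P : Fin (l + 1) → Set C)

/-- `φ(x, X, P)` defines a choice function from the non-empty subsets of `C`. -/
structure DefinesChoice {C : Type u} [LT C] {l : ℕ} (φ : MFormula 1 (l + 1))
    (P : Fin l → Set C) : Prop where
  mem_of_holds : ∀ (a : C) (A : Set C), Holds φ a A P → A.Nonempty ∧ a ∈ A
  exists_holds : ∀ A : Set C, A.Nonempty → ∃ a : C, Holds φ a A P
  unique : ∀ (a b : C) (A : Set C), Holds φ a A P → Holds φ b A P → a = b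

/-- `C` has a monadically definable choice function, with finitely many subsets of `C` as
parameters. -/
def HasDefinableChoice (C : Type u) [LT C] : Prop :=
  ∃ (l : ℕ) (P : Fin l → Set C) (φ : MFormula 1 (l + 1)), DefinesChoice φ P

end MonadicOrder

/-! There are only finitely many types of given depth; types of large enough depth decide a given
formula (`MFormula.exists_depth`), and the type of an ordered sum is determined by those of its
summands (`mtype_iUnion`). So colouring the pairs x < y of a copy of ℚ in C by the type of [x, y)
with the parameters is a finite additive colouring, and `Rat.exists_orderEmbedding_const_pairs`
yields a subcopy of ℚ in which all these intervals have one type.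

Take a sequence s of order type ℤ in this subcopy and let A be its range. A choice function must
pick some s i. The convex hull of A is the sum of the intervals [s j, s (j + 1)), and matching each
with the next, which is possible because ℤ has no endpoints, shows that s i and s (i + 1) have the
same type over A and the parameters (`mtype_shift`), even if no automorphism of C moves one to the
other. The formula then holds at both points, against uniqueness. -/

namespace MonadicOrder

/-! ### Monadic types of subsets of a linear order -/

/-- Monadic types of depth `k` in `n` set variables. A type of depth `0` records which variables
are non-empty, which inclusions hold, and for which pairs of variables some element of the first
lies below some element of the second. -/
def MType : ℕ → ℕ → Type
  | 0, n => (Fin n → Prop) × (Fin n → Fin n → Prop) × (Fin n → Fin n → Prop)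
  | k + 1, n => Set (MType k (n + 1))

instance MType.finite : (k n : ℕ) → Finite (MType k n)
  | 0, n => inferInstanceAs
      (Finite ((Fin n → Prop) × (Fin n → Fin n → Prop) × (Fin n → Fin n → Prop)))
  | k + 1, n => by
      have := MType.finite k (n + 1)
      exact inferInstanceAs (Finite (Set (MType k (n + 1))))

/-- The type of depth `k` of the suborder `S` expanded by the traces of the sets `X i`. -/
def mtype {C : Type*} [LT C] : (k : ℕ) → {n : ℕ} → Set C → (Fin n → Set C) → MType k n
  | 0, _, S, X =>
      (fun i => ∃ x ∈ S, x ∈ X i, fun i j => ∀ x ∈ S, x ∈ X i → x ∈ X j,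
        fun i j => ∃ x ∈ S, ∃ y ∈ S, x ∈ X i ∧ y ∈ X j ∧ x < y)
  | k + 1, _, S, X => Set.range fun A : Set C => mtype k S (Fin.cons A X : Fin _ → Set C)

section MType

variable {C C' : Type*} [LinearOrder C] [LinearOrder C'] {k n : ℕ} {S : Set C} {S' : Set C'}
  {X : Fin n → Set C} {Y : Fin n → Set C'}

theorem mtype_zero_eq_iff : mtype 0 S X = mtype 0 S' Y ↔
    (∀ i, (∃ x ∈ S, x ∈ X i) ↔ ∃ x ∈ S', x ∈ Y i) ∧
    (∀ i j, (∀ x ∈ S, x ∈ X i → x ∈ X j) ↔ ∀ x ∈ S', x ∈ Y i → x ∈ Y j) ∧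
    (∀ i j, (∃ x ∈ S, ∃ y ∈ S, x ∈ X i ∧ y ∈ X j ∧ x < y) ↔
      ∃ x ∈ S', ∃ y ∈ S', x ∈ Y i ∧ y ∈ Y j ∧ x < y) := by
  simp only [mtype]
  refine Prod.mk_inj.trans (and_congr ?_ (Prod.mk_inj.trans (and_congr ?_ ?_)))
  · simp only [funext_iff, eq_iff_iff]
  · simp only [funext_iff, eq_iff_iff]
  · simp only [funext_iff, eq_iff_iff]

theorem exists_mtype_cons_eq (h : mtype (k + 1) S X = mtype (k + 1) S' Y) (A : Set C) :
    ∃ B : Set C', mtype k S (Fin.cons A X : Fin _ → Set C) =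
      mtype k S' (Fin.cons B Y : Fin _ → Set C') := by
  have hA : mtype k S (Fin.cons A X : Fin _ → Set C) ∈ Set.range fun A : Set C =>
      mtype k S (Fin.cons A X : Fin _ → Set C) := ⟨A, rfl⟩
  change Set.range _ = Set.range _ at h
  rw [h] at hA
  obtain ⟨B, hB⟩ := hA
  exact ⟨B, hB.symm⟩

theorem mtype_succ_eq
    (h₁ : ∀ A : Set C, ∃ B : Set C', mtype k S (Fin.cons A X : Fin _ → Set C) =
      mtype k S' (Fin.cons B Y : Fin _ → Set C'))
    (h₂ : ∀ B : Set C', ∃ A : Set C, mtype k S (Fin.cons A X : Fin _ → Set C) =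
      mtype k S' (Fin.cons B Y : Fin _ → Set C')) :
    mtype (k + 1) S X = mtype (k + 1) S' Y := by
  change Set.range _ = Set.range _
  apply Set.Subset.antisymm
  · rintro _ ⟨A, rfl⟩
    obtain ⟨B, hB⟩ := h₁ A
    exact ⟨B, hB.symm⟩
  · rintro _ ⟨B, rfl⟩
    obtain ⟨A, hA⟩ := h₂ B
    exact ⟨A, hA⟩

theorem mtype_eq_of_succ : {k n : ℕ} → {X : Fin n → Set C} → {Y : Fin n → Set C'} →
    mtype (k + 1) S X = mtype (k + 1) S' Y → mtype k S X = mtype k S' Y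
  | 0, _, X, Y, h => by
      obtain ⟨B, hB⟩ := exists_mtype_cons_eq h ∅
      rw [mtype_zero_eq_iff] at hB ⊢
      exact ⟨fun i => by simpa using hB.1 i.succ,
        fun i j => by simpa using hB.2.1 i.succ j.succ,
        fun i j => by simpa using hB.2.2 i.succ j.succ⟩
  | k + 1, _, X, Y, h => by
      refine mtype_succ_eq (fun A => ?_) (fun B => ?_)
      · obtain ⟨B, hB⟩ := exists_mtype_cons_eq h A
        exact ⟨B, mtype_eq_of_succ hB⟩
      · obtain ⟨A, hA⟩ := exists_mtype_cons_eq h.symm B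
        exact ⟨A, mtype_eq_of_succ hA.symm⟩

theorem mtype_eq_of_le {l : ℕ} (hkl : k ≤ l) (h : mtype l S X = mtype l S' Y) :
    mtype k S X = mtype k S' Y := by
  induction l, hkl using Nat.le_induction with
  | base => exact h
  | succ l _ ih => exact ih (mtype_eq_of_succ h)

theorem mtype_congr : {k n : ℕ} → {X Y : Fin n → Set C} →
    (∀ i, ∀ x ∈ S, x ∈ X i ↔ x ∈ Y i) → mtype k S X = mtype k S Y
  | 0, _, X, Y, h => by
      rw [mtype_zero_eq_iff]
      refine ⟨fun i => ?_, fun i j => ?_, fun i j => ?_⟩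
      · exact exists_congr fun x => and_congr_right fun hx => h i x hx
      · exact forall₂_congr fun x hx => by rw [h i x hx, h j x hx]
      · exact exists_congr fun x => and_congr_right fun hx => exists_congr fun y =>
          and_congr_right fun hy => by rw [h i x hx, h j y hy]
  | k + 1, _, X, Y, h => by
      have key : ∀ A : Set C, mtype k S (Fin.cons A X : Fin _ → Set C) =
          mtype k S (Fin.cons A Y : Fin _ → Set C) := fun A =>
        mtype_congr fun i => Fin.cases (by simp) (fun i => by simpa using h i) i
      exact mtype_succ_eq (fun A => ⟨A, key A⟩) (fun A => ⟨A, key A⟩)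

/-- The summands are pairwise disjoint, so sets chosen separately in each of them glue to one set
with the prescribed traces. -/
theorem mem_iUnion_inter_iff {I : Type*} [LinearOrder I] {S : I → Set C}
    (hS : ∀ i j, i < j → ∀ x ∈ S i, ∀ y ∈ S j, x < y) {B : I → Set C} {i : I} {x : C}
    (hx : x ∈ S i) : x ∈ ⋃ j, B j ∩ S j ↔ x ∈ B i := by
  simp only [Set.mem_iUnion, Set.mem_inter_iff]
  refine ⟨?_, fun h => ⟨i, h, hx⟩⟩
  rintro ⟨j, hB, hj⟩
  rcases lt_trichotomy i j with hij | rfl | hij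
  · exact absurd (hS i j hij x hx x hj) (lt_irrefl x)
  · exact hB
  · exact absurd (hS j i hij x hj x hx) (lt_irrefl x)

/-- The type of an ordered sum depends only on the types of the summands. -/
theorem mtype_iUnion {I : Type*} [LinearOrder I] {S : I → Set C} {S' : I → Set C'}
    (hS : ∀ i j, i < j → ∀ x ∈ S i, ∀ y ∈ S j, x < y)
    (hS' : ∀ i j, i < j → ∀ x ∈ S' i, ∀ y ∈ S' j, x < y) :
    {k n : ℕ} → {X : Fin n → Set C} → {Y : Fin n → Set C'} →
    (∀ i, mtype k (S i) X = mtype k (S' i) Y) → mtype k (⋃ i, S i) X = mtype k (⋃ i, S' i) Y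
  | 0, _, X, Y, h => by
      simp only [mtype_zero_eq_iff] at h
      rw [mtype_zero_eq_iff]
      simp only [Set.mem_iUnion]
      refine ⟨fun i => ?_, fun i j => ?_, fun i j => ⟨?_, ?_⟩⟩
      · constructor
        · rintro ⟨x, ⟨s, hs⟩, hx⟩
          obtain ⟨y, hy, hyY⟩ := ((h s).1 i).1 ⟨x, hs, hx⟩
          exact ⟨y, ⟨s, hy⟩, hyY⟩
        · rintro ⟨x, ⟨s, hs⟩, hx⟩
          obtain ⟨y, hy, hyY⟩ := ((h s).1 i).2 ⟨x, hs, hx⟩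
          exact ⟨y, ⟨s, hy⟩, hyY⟩
      · constructor
        · rintro H x ⟨s, hs⟩
          exact ((h s).2.1 i j).1 (fun y hy => H y ⟨s, hy⟩) x hs
        · rintro H x ⟨s, hs⟩
          exact ((h s).2.1 i j).2 (fun y hy => H y ⟨s, hy⟩) x hs
      · rintro ⟨x, ⟨s, hs⟩, y, ⟨t, ht⟩, hx, hy, hxy⟩
        rcases lt_trichotomy s t with hst | rfl | hst
        · obtain ⟨x', hx', hxY⟩ := ((h s).1 i).1 ⟨x, hs, hx⟩
          obtain ⟨y', hy', hyY⟩ := ((h t).1 j).1 ⟨y, ht, hy⟩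
          exact ⟨x', ⟨s, hx'⟩, y', ⟨t, hy'⟩, hxY, hyY, hS' s t hst _ hx' _ hy'⟩
        · obtain ⟨x', hx', y', hy', H⟩ := ((h s).2.2 i j).1 ⟨x, hs, y, ht, hx, hy, hxy⟩
          exact ⟨x', ⟨s, hx'⟩, y', ⟨s, hy'⟩, H⟩
        · exact absurd (hS t s hst _ ht _ hs) hxy.not_gt
      · rintro ⟨x, ⟨s, hs⟩, y, ⟨t, ht⟩, hx, hy, hxy⟩
        rcases lt_trichotomy s t with hst | rfl | hst
        · obtain ⟨x', hx', hxY⟩ := ((h s).1 i).2 ⟨x, hs, hx⟩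
          obtain ⟨y', hy', hyY⟩ := ((h t).1 j).2 ⟨y, ht, hy⟩
          exact ⟨x', ⟨s, hx'⟩, y', ⟨t, hy'⟩, hxY, hyY, hS s t hst _ hx' _ hy'⟩
        · obtain ⟨x', hx', y', hy', H⟩ := ((h s).2.2 i j).2 ⟨x, hs, y, ht, hx, hy, hxy⟩
          exact ⟨x', ⟨s, hx'⟩, y', ⟨s, hy'⟩, H⟩
        · exact absurd (hS' t s hst _ ht _ hs) hxy.not_gt
  | k + 1, _, X, Y, h => by
      refine mtype_succ_eq (fun A => ?_) (fun B => ?_)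
      · choose B hB using fun i => exists_mtype_cons_eq (h i) A
        refine ⟨⋃ i, B i ∩ S' i, mtype_iUnion hS hS' fun i => (hB i).trans (mtype_congr fun j =>
          Fin.cases (fun x hx => ?_) (fun j => by simp) j)⟩
        exact (mem_iUnion_inter_iff hS' hx).symm
      · choose A hA using fun i => exists_mtype_cons_eq (h i).symm B
        refine ⟨⋃ i, A i ∩ S i, mtype_iUnion hS hS' fun i => Eq.trans (mtype_congr fun j =>
          Fin.cases (fun x hx => ?_) (fun j => by simp) j) (hA i).symm⟩
        exact mem_iUnion_inter_iff hS hx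

end MType

end MonadicOrder

/-! ### Additive colourings of the rationals -/

theorem Rat.exists_orderEmbedding_Ioo {a b : ℚ} (h : a < b) :
    ∃ f : ℚ ↪o ℚ, ∀ q, a < f q ∧ f q < b := by
  have : Nontrivial (Set.Ioo a b) := by
    obtain ⟨c, hac, hcb⟩ := exists_between h
    obtain ⟨d, hcd, hdb⟩ := exists_between hcb
    exact ⟨⟨c, hac, hcb⟩, ⟨d, hac.trans hcd, hdb⟩, fun e => hcd.ne (congrArg Subtype.val e)⟩
  obtain ⟨f⟩ := Order.embedding_from_countable_to_dense ℚ (Set.Ioo a b)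
  exact ⟨f.trans (OrderEmbedding.subtype _), fun q => (f q).2⟩

/-- With finitely many colours, a copy of ℚ with a minimal colour set exists; on it no colour can be
lost by passing to a subcopy. -/
theorem Rat.exists_orderEmbedding_minimal {α : Type*} [Finite α] (V : (ℚ ↪o ℚ) → Set α)
    (hV : ∀ h g : ℚ ↪o ℚ, V (h.trans g) ⊆ V g) :
    ∃ g : ℚ ↪o ℚ, ∀ h : ℚ ↪o ℚ, V g ⊆ V (h.trans g) := by
  obtain ⟨g, -, hg⟩ := exists_minimalFor_of_wellFoundedLT (fun _ : ℚ ↪o ℚ => True) V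
    ⟨RelEmbedding.refl _, trivial⟩
  exact ⟨g, fun h => hg trivial (hV h g)⟩

/-- Every finite colouring of `ℚ` is constant on a copy of `ℚ`. -/
theorem Rat.exists_orderEmbedding_const {α : Type*} [Finite α] (c : ℚ → α) :
    ∃ (f : ℚ ↪o ℚ) (a : α), ∀ q, c (f q) = a := by
  obtain ⟨g, hg⟩ := Rat.exists_orderEmbedding_minimal (fun g => Set.range fun q => c (g q))
    (by rintro h g _ ⟨q, rfl⟩; exact ⟨h q, rfl⟩)
  -- By minimality the colour of 0 recurs in every interval, so its colour class is dense.
  let T : Set ℚ := {q | c (g q) = c (g 0)}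
  have hT : ∀ a b : ℚ, a < b → ∃ q ∈ T, a < q ∧ q < b := by
    intro a b hab
    obtain ⟨h, hh⟩ := Rat.exists_orderEmbedding_Ioo hab
    obtain ⟨q, hq⟩ := hg h ⟨0, rfl⟩
    exact ⟨h q, hq, hh q⟩
  have : DenselyOrdered T := ⟨fun a b hab => by
    obtain ⟨q, hq, haq, hqb⟩ := hT a b hab
    exact ⟨⟨q, hq⟩, haq, hqb⟩⟩
  have : Nontrivial T := by
    obtain ⟨q, hq, h0, -⟩ := hT 0 1 one_pos
    exact ⟨⟨0, rfl⟩, ⟨q, hq⟩, fun e => h0.ne (congrArg Subtype.val e)⟩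
  obtain ⟨f⟩ := Order.embedding_from_countable_to_dense ℚ T
  exact ⟨(f.trans (OrderEmbedding.subtype _)).trans g, c (g 0), fun q => (f q).2⟩

/-- Additive Ramsey theorem for the rationals: a finite colouring of the pairs `x < y` of
rationals such that the colours of `x < y` and of `y < z` determine that of `x < z` is constant on
a copy of `ℚ`. -/
theorem Rat.exists_orderEmbedding_const_pairs {α : Type*} [Finite α] (f : ℚ → ℚ → α)
    (hf : ∀ x y z x' y' z' : ℚ, x < y → y < z → x' < y' → y' < z' →
      f x y = f x' y' → f y z = f y' z' → f x z = f x' z') :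
    ∃ (g : ℚ ↪o ℚ) (a : α), ∀ p q, p < q → f (g p) (g q) = a := by
  obtain ⟨g, hg⟩ := Rat.exists_orderEmbedding_minimal
    (fun g => {v | ∃ p q, p < q ∧ f (g p) (g q) = v})
    (by rintro h g _ ⟨p, q, hpq, rfl⟩; exact ⟨h p, h q, h.lt_iff_lt.2 hpq, rfl⟩)
  have hrec : ∀ (h : ℚ ↪o ℚ) (x y : ℚ), x < y →
      ∃ p q, p < q ∧ f (g (h p)) (g (h q)) = f (g x) (g y) :=
    fun h x y hxy => hg h ⟨x, y, hxy, rfl⟩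
  have hadd : ∀ x y z x' y' z' : ℚ, x < y → y < z → x' < y' → y' < z' →
      f (g x) (g y) = f (g x') (g y') → f (g y) (g z) = f (g y') (g z') →
      f (g x) (g z) = f (g x') (g z') := fun x y z x' y' z' h₁ h₂ h₃ h₄ =>
    hf _ _ _ _ _ _ (g.lt_iff_lt.2 h₁) (g.lt_iff_lt.2 h₂) (g.lt_iff_lt.2 h₃) (g.lt_iff_lt.2 h₄)
  have hbetween : ∀ s t x y : ℚ, s < t → x < y →
      ∃ p q, s < p ∧ p < q ∧ q < t ∧ f (g p) (g q) = f (g x) (g y) := by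
    intro s t x y hst hxy
    obtain ⟨h, hh⟩ := Rat.exists_orderEmbedding_Ioo hst
    obtain ⟨p, q, hpq, e⟩ := hrec h x y hxy
    exact ⟨h p, h q, (hh p).1, h.lt_iff_lt.2 hpq, (hh q).2, e⟩
  -- a colour absorbing every colour on its right
  obtain ⟨a₀, a₁, ha, hright⟩ : ∃ a₀ a₁ : ℚ, a₀ < a₁ ∧ ∀ x y z, x < y → y < z →
      f (g x) (g y) = f (g a₀) (g a₁) → f (g x) (g z) = f (g a₀) (g a₁) := by
    obtain ⟨i, hi⟩ := Rat.exists_orderEmbedding_Ioo (zero_lt_one (α := ℚ))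
    obtain ⟨j, a, hj⟩ := Rat.exists_orderEmbedding_const fun q => f (g 0) (g (i q))
    refine ⟨0, i (j 0), (hi _).1, fun x y z hxy hyz h => ?_⟩
    -- The colour of (y, z) recurs on a pair p < q inside the copy whose points all have the same
    -- colour as seen from 0; additivity through p transfers this to (x, z).
    obtain ⟨p, q, hpq, e⟩ := hrec (j.trans i) y z hyz
    rw [hj 0] at h ⊢
    rw [← hj q]
    exact hadd x y z 0 (i (j p)) (i (j q)) hxy hyz (hi _).1 (i.lt_iff_lt.2 (j.lt_iff_lt.2 hpq))
      (h.trans (hj p).symm) e.symm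
  -- a colour absorbing every colour on its left
  obtain ⟨b₀, b₁, hb, hleft⟩ : ∃ b₀ b₁ : ℚ, b₀ < b₁ ∧ ∀ x y z, x < y → y < z →
      f (g y) (g z) = f (g b₀) (g b₁) → f (g x) (g z) = f (g b₀) (g b₁) := by
    obtain ⟨i, hi⟩ := Rat.exists_orderEmbedding_Ioo (zero_lt_one (α := ℚ))
    obtain ⟨j, b, hj⟩ := Rat.exists_orderEmbedding_const fun q => f (g (i q)) (g 1)
    refine ⟨i (j 0), 1, (hi _).2, fun x y z hxy hyz h => ?_⟩
    obtain ⟨p, q, hpq, e⟩ := hrec (j.trans i) x y hxy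
    rw [hj 0] at h ⊢
    rw [← hj p]
    exact hadd x y z (i (j p)) (i (j q)) 1 hxy hyz (i.lt_iff_lt.2 (j.lt_iff_lt.2 hpq)) (hi _).2
      e.symm (h.trans (hj q).symm)
  have hab : f (g a₀) (g a₁) = f (g b₀) (g b₁) := by
    -- With a pair of the second colour to the right of one of the first, the spanning pair has both
    -- colours.
    obtain ⟨p, q, hp, hpq, -, e⟩ := hbetween a₁ (a₁ + 1) b₀ b₁ (lt_add_one _) hb
    rw [← hright a₀ a₁ q ha (hp.trans hpq) rfl]
    exact hleft a₀ p q (ha.trans hp) hpq e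
  refine ⟨g, f (g a₀) (g a₁), fun x z hxz => ?_⟩
  obtain ⟨p, q, hp, hpq, hq, e⟩ := hbetween x z a₀ a₁ hxz ha
  rw [hab]
  exact hleft x p z hp (hpq.trans hq) ((hright p q z hpq hq e).trans hab)

namespace MonadicOrder

/-! ### Types of intervals and marked points, and their control over formulas -/

section Choice

variable {C : Type*} [LinearOrder C]

/-- Half-open intervals add up without overlap: [x, z) is the sum of [x, y) and [y, z), indexed by
`false < true`. This is the additivity that the Ramsey theorem needs. -/
theorem mtype_Ico_eq {k n : ℕ} {P : Fin n → Set C} {x y z x' y' z' : C} (hxy : x < y)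
    (hyz : y < z) (hxy' : x' < y') (hyz' : y' < z')
    (h₁ : mtype k (Set.Ico x y) P = mtype k (Set.Ico x' y') P)
    (h₂ : mtype k (Set.Ico y z) P = mtype k (Set.Ico y' z') P) :
    mtype k (Set.Ico x z) P = mtype k (Set.Ico x' z') P := by
  have key : ∀ {x y z : C}, x < y → y < z →
      (⋃ b : Bool, cond b (Set.Ico y z) (Set.Ico x y)) = Set.Ico x z ∧
      ∀ b c : Bool, b < c → ∀ u ∈ cond b (Set.Ico y z) (Set.Ico x y),
        ∀ v ∈ cond c (Set.Ico y z) (Set.Ico x y), u < v := by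
    intro x y z hxy hyz
    constructor
    · rw [← Set.union_eq_iUnion, Set.union_comm, Set.Ico_union_Ico_eq_Ico hxy.le hyz.le]
    · rintro (_ | _) (_ | _) hbc u hu v hv
      · exact absurd hbc (lt_irrefl _)
      · exact hu.2.trans_le hv.1
      · exact absurd hbc (by decide)
      · exact absurd hbc (lt_irrefl _)
  rw [← (key hxy hyz).1, ← (key hxy' hyz').1]
  refine mtype_iUnion (key hxy hyz).2 (key hxy' hyz').2 ?_
  rintro (_ | _)
  · exact h₁
  · exact h₂

/-- The least element of a suborder is definable, so it can be added to the variables. -/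
theorem mtype_cons_least {k n : ℕ} {S S' : Set C} {X Y : Fin n → Set C} {a a' : C}
    (ha : IsLeast S a) (ha' : IsLeast S' a')
    (h : mtype (k + 2) S X = mtype (k + 2) S' Y) :
    mtype (k + 1) S (Fin.cons {a} X : Fin _ → Set C) =
      mtype (k + 1) S' (Fin.cons {a'} Y : Fin _ → Set C) := by
  obtain ⟨B, hB⟩ := exists_mtype_cons_eq h {a}
  rw [hB]
  refine mtype_congr fun i => Fin.cases (fun x hx => ?_) (fun i => by simp) i
  have h0 := mtype_zero_eq_iff.1 (mtype_eq_of_le (Nat.zero_le _) hB)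
  have hne := h0.1 0
  have hlt := h0.2.2 0 0
  simp only [Fin.cons_zero, Set.mem_singleton_iff] at hne hlt ⊢
  have hsub : ∀ u ∈ S', ∀ v ∈ S', u ∈ B → v ∈ B → ¬ u < v := by
    intro u hu v hv huB hvB huv
    obtain ⟨p, -, q, -, rfl, rfl, hpq⟩ := hlt.2 ⟨u, hu, v, hv, huB, hvB, huv⟩
    exact lt_irrefl _ hpq
  obtain ⟨b, hb, hbB⟩ := hne.1 ⟨a, ha.1, rfl⟩
  -- Otherwise {a'} has an element below one of B; one more set variable would transfer this to an
  -- element of S below a.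
  have hba : b = a' := by
    by_contra hne'
    obtain ⟨D, hD⟩ := exists_mtype_cons_eq hB.symm {a'}
    have hD2 := (mtype_zero_eq_iff.1 (mtype_eq_of_le (Nat.zero_le _) hD)).2.2 0 1
    obtain ⟨u, hu, v, -, -, hv, huv⟩ := hD2.1
      ⟨a', ha'.1, b, hb, rfl, hbB, lt_of_le_of_ne (ha'.2 hb) (Ne.symm hne')⟩
    have hv : v = a := hv
    exact (ha.2 hu).not_gt (hv ▸ huv)
  subst hba
  constructor
  · intro hxB
    rcases lt_trichotomy x b with hlt' | rfl | hlt'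
    · exact absurd hlt' (hsub _ hx _ hb hxB hbB)
    · rfl
    · exact absurd hlt' (hsub _ hb _ hx hbB hxB)
  · rintro rfl
    exact hbB

/-- The type of a suborder determines its type after adding two variables, one interpreted by the
least element and the other by the least element or the empty set. -/
theorem mtype_cons_cons_least {k n : ℕ} {S S' : Set C} {X Y : Fin n → Set C} {a a' : C}
    (ha : IsLeast S a) (ha' : IsLeast S' a') (h : mtype (k + 3) S X = mtype (k + 3) S' Y)
    {A A' B B' : Set C} (hA : ∀ x ∈ S, x ∈ A ↔ x = a) (hA' : ∀ x ∈ S', x ∈ A' ↔ x = a')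
    (hB : ∀ x ∈ S, x ∈ B → x = a) (hB' : ∀ x ∈ S', x ∈ B' → x = a') (hBB' : a ∈ B ↔ a' ∈ B') :
    mtype k S (Fin.cons B (Fin.cons A X) : Fin _ → Set C) =
      mtype k S' (Fin.cons B' (Fin.cons A' Y) : Fin _ → Set C) := by
  have h₁ := mtype_cons_least ha ha' h
  have key : mtype (k + 2) S (Fin.cons A X : Fin _ → Set C) =
      mtype (k + 2) S' (Fin.cons A' Y : Fin _ → Set C) := by
    refine Eq.trans (mtype_congr fun i => ?_) (h₁.trans (mtype_congr fun i => ?_))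
    · exact Fin.cases (fun x hx => hA x hx) (fun i => by simp) i
    · exact Fin.cases (fun x hx => (hA' x hx).symm) (fun i => by simp) i
  by_cases hb : a ∈ B
  · refine Eq.trans (mtype_congr fun i => ?_)
      ((mtype_eq_of_succ (mtype_cons_least ha ha' key)).trans (mtype_congr fun i => ?_))
    · refine Fin.cases (fun x hx => ⟨hB x hx, ?_⟩) (fun i => by simp) i
      rintro rfl
      exact hb
    · refine Fin.cases (fun x hx => ⟨?_, hB' x hx⟩) (fun i => by simp) i
      rintro rfl
      exact hBB'.1 hb
  · have hBe : ∀ x ∈ S, x ∉ B := fun x hx hxB => hb (hB x hx hxB ▸ hxB)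
    have hBe' : ∀ x ∈ S', x ∉ B' := fun x hx hxB => hb (hBB'.2 (hB' x hx hxB ▸ hxB))
    obtain ⟨D, hD⟩ := exists_mtype_cons_eq (mtype_eq_of_succ key) B
    refine hD.trans (mtype_congr fun i => Fin.cases (fun x hx => ?_) (fun i => by simp) i)
    have hne := (mtype_zero_eq_iff.1 (mtype_eq_of_le (Nat.zero_le _) hD)).1 0
    refine iff_of_false (fun hxD => ?_) (hBe' x hx)
    obtain ⟨y, hy, hyB⟩ := hne.2 ⟨x, hx, hxD⟩
    exact hBe y hy hyB

/-- Depth 0 already records that a variable is non-empty and has no two members one below the other.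
-/
theorem exists_eq_singleton_of_mtype_eq {k n : ℕ} {X Y : Fin n → Set C} {a : C} {B : Set C}
    (h : mtype k Set.univ (Fin.cons {a} X : Fin _ → Set C) =
      mtype k Set.univ (Fin.cons B Y : Fin _ → Set C)) : ∃ b, B = {b} := by
  have h0 := mtype_zero_eq_iff.1 (mtype_eq_of_le (Nat.zero_le _) h)
  obtain ⟨b, -, hb⟩ := (h0.1 0).1 ⟨a, trivial, rfl⟩
  have hsub : ∀ u v, u ∈ B → v ∈ B → ¬ u < v := by
    intro u v hu hv huv
    obtain ⟨p, -, q, -, hp, hq, hpq⟩ := (h0.2.2 0 0).2 ⟨u, trivial, v, trivial, hu, hv, huv⟩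
    have hp : p = a := hp
    have hq : q = a := hq
    exact (hp.trans hq.symm).not_lt hpq
  refine ⟨b, Set.eq_singleton_iff_unique_mem.2 ⟨hb, fun x hx => ?_⟩⟩
  rcases lt_trichotomy x b with hlt | rfl | hlt
  · exact absurd hlt (hsub _ _ hx hb)
  · rfl
  · exact absurd hlt (hsub _ _ hb hx)

/-- A formula is decided by the type of some depth of the sets and singletons interpreting its
variables. -/
theorem MFormula.exists_depth {m n : ℕ} (φ : MFormula m n) : ∃ k : ℕ, ∀ (N : ℕ)
    (ρ : Fin m → Fin N) (σ : Fin n → Fin N) (Z Z' : Fin N → Set C) (x x' : Fin m → C),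
    (∀ i, Z (ρ i) = {x i}) → (∀ i, Z' (ρ i) = {x' i}) →
    mtype k Set.univ Z = mtype k Set.univ Z' →
    (φ.Realize x (fun i => Z (σ i)) ↔ φ.Realize x' (fun i => Z' (σ i))) := by
  -- The maps ρ and σ are general because each quantifier, of either sort, puts its new variable at
  -- the front of the single list Z.
  induction φ with
  | eq i j =>
    refine ⟨0, fun N ρ σ Z Z' x x' hx hx' h => ?_⟩
    simpa [hx, hx', MFormula.Realize] using (mtype_zero_eq_iff.1 h).2.1 (ρ i) (ρ j)
  | lt i j =>
    refine ⟨0, fun N ρ σ Z Z' x x' hx hx' h => ?_⟩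
    simpa [hx, hx', MFormula.Realize] using (mtype_zero_eq_iff.1 h).2.2 (ρ i) (ρ j)
  | mem i j =>
    refine ⟨0, fun N ρ σ Z Z' x x' hx hx' h => ?_⟩
    simpa [hx, hx', MFormula.Realize] using (mtype_zero_eq_iff.1 h).2.1 (ρ i) (σ j)
  | neg φ ih =>
    obtain ⟨k, hk⟩ := ih
    exact ⟨k, fun N ρ σ Z Z' x x' hx hx' h => not_congr (hk N ρ σ Z Z' x x' hx hx' h)⟩
  | and φ ψ ih₁ ih₂ =>
    obtain ⟨k, hk⟩ := ih₁
    obtain ⟨l, hl⟩ := ih₂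
    exact ⟨max k l, fun N ρ σ Z Z' x x' hx hx' h => and_congr
      (hk N ρ σ Z Z' x x' hx hx' (mtype_eq_of_le (le_max_left _ _) h))
      (hl N ρ σ Z Z' x x' hx hx' (mtype_eq_of_le (le_max_right _ _) h))⟩
  | @exElem m n φ ih =>
    obtain ⟨k, hk⟩ := ih
    have key : ∀ (N : ℕ) (ρ : Fin m → Fin N) (σ : Fin n → Fin N) (Z Z' : Fin N → Set C)
        (x x' : Fin m → C), (∀ i, Z (ρ i) = {x i}) → (∀ i, Z' (ρ i) = {x' i}) →
        mtype (k + 1) Set.univ Z = mtype (k + 1) Set.univ Z' →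
        φ.exElem.Realize x (fun i => Z (σ i)) → φ.exElem.Realize x' (fun i => Z' (σ i)) := by
      rintro N ρ σ Z Z' x x' hx hx' h ⟨a, ha⟩
      obtain ⟨B, hB⟩ := exists_mtype_cons_eq h {a}
      obtain ⟨b, rfl⟩ := exists_eq_singleton_of_mtype_eq hB
      refine ⟨b, (hk (N + 1) (Fin.cons 0 fun i => (ρ i).succ) (fun i => (σ i).succ) _ _ _ _
        ?_ ?_ hB).1 ha⟩
      · exact fun i => Fin.cases (by simp) (fun i => by simpa using hx i) i
      · exact fun i => Fin.cases (by simp) (fun i => by simpa using hx' i) i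
    exact ⟨k + 1, fun N ρ σ Z Z' x x' hx hx' h =>
      ⟨key N ρ σ Z Z' x x' hx hx' h, key N ρ σ Z' Z x' x hx' hx h.symm⟩⟩
  | @exSet m n φ ih =>
    obtain ⟨k, hk⟩ := ih
    have key : ∀ (N : ℕ) (ρ : Fin m → Fin N) (σ : Fin n → Fin N) (Z Z' : Fin N → Set C)
        (x x' : Fin m → C), (∀ i, Z (ρ i) = {x i}) → (∀ i, Z' (ρ i) = {x' i}) →
        mtype (k + 1) Set.univ Z = mtype (k + 1) Set.univ Z' →
        φ.exSet.Realize x (fun i => Z (σ i)) → φ.exSet.Realize x' (fun i => Z' (σ i)) := by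
      rintro N ρ σ Z Z' x x' hx hx' h ⟨A, hA⟩
      obtain ⟨B, hB⟩ := exists_mtype_cons_eq h A
      have cons_comp : ∀ (A : Set C) (Z : Fin N → Set C),
          (fun i => (Fin.cons A Z : Fin (N + 1) → Set C)
            ((Fin.cons 0 fun i => (σ i).succ : Fin (n + 1) → Fin (N + 1)) i)) =
          (Fin.cons A fun i => Z (σ i) : Fin (n + 1) → Set C) := by
        intro A Z
        funext i
        exact Fin.cases (by simp) (fun i => by simp) i
      have := hk (N + 1) (fun i => (ρ i).succ) (Fin.cons 0 fun i => (σ i).succ) _ _ x x'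
        (by simpa using hx) (by simpa using hx') hB
      rw [cons_comp, cons_comp] at this
      exact ⟨B, this.1 hA⟩
    exact ⟨k + 1, fun N ρ σ Z Z' x x' hx hx' h =>
      ⟨key N ρ σ Z Z' x x' hx hx' h, key N ρ σ Z' Z x' x hx' hx h.symm⟩⟩

theorem exists_depth_holds {l : ℕ} (φ : MFormula 1 (l + 1)) : ∃ k : ℕ,
    ∀ (a b : C) (A : Set C) (P : Fin l → Set C),
    mtype k Set.univ (Fin.cons {a} (Fin.cons A P) : Fin _ → Set C) =
      mtype k Set.univ (Fin.cons {b} (Fin.cons A P) : Fin _ → Set C) →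
    (Holds φ a A P ↔ Holds φ b A P) := by
  obtain ⟨k, hk⟩ := φ.exists_depth (C := C)
  refine ⟨k, fun a b A P h => ?_⟩
  exact hk (l + 2) (fun _ => 0) Fin.succ _ _ (fun _ => a) (fun _ => b)
    (fun _ => rfl) (fun _ => rfl) h

/-- Shifting the marked point along a sequence of order type `ℤ` with intervals of equal type. -/
theorem mtype_shift {k l : ℕ} {P : Fin l → Set C} {s : ℤ → C} (hs : StrictMono s)
    (h : ∀ i, mtype (k + 3) (Set.Ico (s i) (s (i + 1))) P =
      mtype (k + 3) (Set.Ico (s (i + 1)) (s (i + 1 + 1))) P) (i : ℤ) :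
    mtype k Set.univ (Fin.cons {s i} (Fin.cons (Set.range s) P) : Fin _ → Set C) =
      mtype k Set.univ (Fin.cons {s (i + 1)} (Fin.cons (Set.range s) P) : Fin _ → Set C) := by
  have hrange : ∀ j, ∀ x ∈ Set.Ico (s j) (s (j + 1)), x ∈ Set.range s ↔ x = s j := by
    rintro j _ hx
    constructor
    · rintro ⟨m, rfl⟩
      have h₁ := hs.le_iff_le.1 hx.1
      have h₂ := hs.lt_iff_lt.1 hx.2
      rw [show m = j by omega]
    · rintro rfl
      exact ⟨j, rfl⟩
  have hmono : ∀ j m, j < m → ∀ x ∈ Set.Ico (s j) (s (j + 1)),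
      ∀ y ∈ Set.Ico (s m) (s (m + 1)), x < y := fun j m hjm x hx y hy =>
    hx.2.trans_le ((hs.monotone (by omega)).trans hy.1)
  let M : Set C := ⋃ j, Set.Ico (s j) (s (j + 1))
  -- The same hull, with its summands reindexed by one: the j-th summand here is the (j + 1)-st
  -- above, and it contains s (i + 1) exactly when the original j-th one contains s i.
  have hM : M = ⋃ j, Set.Ico (s (j + 1)) (s (j + 1 + 1)) :=
    ((Equiv.addRight (1 : ℤ)).surjective.iUnion_comp
      fun j => Set.Ico (s j) (s (j + 1))).symm
  have hmid : mtype k M (Fin.cons {s i} (Fin.cons (Set.range s) P) : Fin _ → Set C) =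
      mtype k M (Fin.cons {s (i + 1)} (Fin.cons (Set.range s) P) : Fin _ → Set C) := by
    conv_rhs => rw [hM]
    refine mtype_iUnion hmono (fun j m hjm => hmono _ _ (by omega)) fun j => ?_
    have least : ∀ j, IsLeast (Set.Ico (s j) (s (j + 1))) (s j) := fun j =>
      isLeast_Ico (hs (by omega))
    refine mtype_cons_cons_least (least j) (least (j + 1)) (h j) (hrange j) (hrange (j + 1))
      ?_ ?_ ?_
    · rintro x hx rfl
      exact (hrange j _ hx).1 ⟨i, rfl⟩
    · rintro x hx rfl
      exact (hrange (j + 1) _ hx).1 ⟨i + 1, rfl⟩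
    · simp [hs.injective.eq_iff]
  have hMmem : ∀ x, x ∈ M ↔ (∃ j, s j ≤ x) ∧ ∃ j, x < s j := by
    intro x
    simp only [M, Set.mem_iUnion]
    constructor
    · rintro ⟨j, h₁, h₂⟩
      exact ⟨⟨j, h₁⟩, ⟨_, h₂⟩⟩
    · rintro ⟨⟨j, hj⟩, ⟨m, hm⟩⟩
      obtain ⟨t, ht, hmax⟩ := Int.exists_greatest_of_bdd (P := fun j => s j ≤ x)
        ⟨m, fun z hz => (hs.lt_iff_lt.1 (hz.trans_lt hm)).le⟩ ⟨j, hj⟩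
      exact ⟨t, ht, lt_of_not_ge fun hge => by have := hmax _ hge; omega⟩
  -- C is the sum of the points below the sequence, its hull, and the points above; the outer parts
  -- contain no s j, so the mark is invisible there.
  let T : Fin 3 → Set C := ![{x | ∀ j, x < s j}, M, {x | ∀ j, s j ≤ x}]
  have hT : ∀ p q, p < q → ∀ x ∈ T p, ∀ y ∈ T q, x < y := by
    intro p q hpq x hx y hy
    fin_cases p <;> fin_cases q <;> first | exact absurd hpq (by decide) | skip
    · obtain ⟨j, hj⟩ := ((hMmem y).1 hy).1
      exact (hx j).trans_le hj
    · exact (hx 0).trans_le (hy 0)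
    · obtain ⟨j, hj⟩ := ((hMmem x).1 hx).2
      exact hj.trans_le (hy j)
  have hTuniv : (⋃ p, T p) = Set.univ := by
    refine Set.eq_univ_of_forall fun x => Set.mem_iUnion.2 ?_
    by_cases h₁ : ∃ j, s j ≤ x
    · by_cases h₂ : ∃ j, x < s j
      · exact ⟨1, (hMmem x).2 ⟨h₁, h₂⟩⟩
      · push Not at h₂
        exact ⟨2, h₂⟩
    · push Not at h₁
      exact ⟨0, h₁⟩
  rw [← hTuniv]
  refine mtype_iUnion hT hT fun p => ?_
  have houter : ∀ S : Set C, (∀ j, s j ∉ S) →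
      mtype k S (Fin.cons {s i} (Fin.cons (Set.range s) P) : Fin _ → Set C) =
      mtype k S (Fin.cons {s (i + 1)} (Fin.cons (Set.range s) P) : Fin _ → Set C) := by
    refine fun S hS => mtype_congr fun p => Fin.cases (fun x hx => ?_) (fun _ => by simp) p
    refine iff_of_false ?_ ?_
    · rintro rfl
      exact hS _ hx
    · rintro rfl
      exact hS _ hx
  fin_cases p
  · exact houter _ fun j hj => lt_irrefl _ (hj j)
  · exact hmid
  · exact houter _ fun j hj => (hj (j + 1)).not_gt (hs (by omega))

end Choice

end MonadicOrder

theorem claim2p4 {C : Type*} [LinearOrder C]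
    {D : Type*} [LinearOrder D] [DenselyOrdered D] [Nontrivial D] (e : D ↪o C) :
    ¬ MonadicOrder.HasDefinableChoice C := by
  rintro ⟨l, P, φ, hφ⟩
  obtain ⟨k, hk⟩ := MonadicOrder.exists_depth_holds (C := C) φ
  obtain ⟨d⟩ := Order.embedding_from_countable_to_dense ℚ D
  let c : ℚ ↪o C := d.trans e
  obtain ⟨g, t, hg⟩ := Rat.exists_orderEmbedding_const_pairs
    (fun x y => MonadicOrder.mtype (k + 3) (Set.Ico (c x) (c y)) P)
    (fun x y z x' y' z' h₁ h₂ h₃ h₄ => MonadicOrder.mtype_Ico_eq (c.lt_iff_lt.2 h₁)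
      (c.lt_iff_lt.2 h₂) (c.lt_iff_lt.2 h₃) (c.lt_iff_lt.2 h₄))
  let s : ℤ → C := fun i => c (g i)
  have hs : StrictMono s := fun i j hij =>
    c.lt_iff_lt.2 (g.lt_iff_lt.2 (Int.cast_lt.2 hij))
  obtain ⟨a, ha⟩ := hφ.exists_holds (Set.range s) ⟨s 0, 0, rfl⟩
  obtain ⟨i, rfl⟩ := (hφ.mem_of_holds _ _ ha).2
  have hshift := MonadicOrder.mtype_shift (k := k) (P := P) hs (fun j =>
    (hg _ _ (Int.cast_lt.2 (by omega))).trans (hg _ _ (Int.cast_lt.2 (by omega))).symm) i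
  exact (hs (lt_add_one i)).ne (hφ.unique _ _ _ ha ((hk _ _ _ _ hshift).1 ha))
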